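/- **Theorem (upper bound, receiver cooperation).** Let $K\ge 2$ and let $(h_{ij})\in\mathbb C^{K\times K}$ satisfy $h_{i+1,i}\neq 0$ for all $i$ (indices modulo $K$). Consider the $K$-user Gaussian interference channel $$y_i(t)=\sum_{j=1}^K h_{ij}x_j(t)+z_i(t),\qquad i=1,\dots,K,\quad t=1,\dots,n,$$ where the noise samples $z_i(t)$ are i.i.d. circularly-symmetric complex Gaussian with mean $0$ and variance $1$, independent of the messages. A scheme of block length $n$, power $P$ and rates $R_1,\dots,R_K\ge 0$ consists of the following. * Independent messages $W_i$, uniform on $\{1,\dots,\lfloor 2^{nR_i}\rfloor\}$, and encoders that map each value of $W_i$ to a codeword $(x_i(t))_{t=1}^n\in\mathbb C^n$ with $\frac1n\sum_{t}|x_i(t)|^2\le P$. * For each ordered pair $i\ne j$ a noiseless backhaul link from receiver $i$ to receiver $j$ with a finite alphabet. Its symbol $m_{i\to j}(t)$ at time $t$ is a measurable function of $(y_i(\tau))_{\tau<t}$ and of all $(m_{\ell\to i}(\tau))_{\tau<t}$, $\ell\neq i$. * Decoders that produce an estimate $\hat W_i$ of $W_i$ as a measurable function of $(y_i(\tau))_{\tau\le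 n}$ and of all $(m_{\ell\to i}(\tau))_{\tau\le n}$, $\ell\ne i$. The average backhaul rate of the scheme is $\overline R_{\rm b}=\frac1K\sum_{i}\sum_{j\ne i}\frac1n H\big((m_{i\to j}(\tau))_{\tau\le n}\big)$, with entropy in bits. For $L\in[0,\infty]$, the tuple $(R_1,\dots,R_K)$ is achievable with power $P$ under the backhaul constraint $L$ if for every $\epsilon>0$ and all sufficiently large $n$ there is such a scheme with $\mathbb P(\exists i:\hat W_i\neq W_i)<\epsilon$ and $\overline R_{\rm b}\le L$. For $\alpha\in[0,\infty]$, let $$\mathsf{DoF}^*(\alpha)=\sup\ \liminf_{P\to\infty}\frac{1}{K\log_2 P}\sum_{k=1}^K R_k(P),$$ where the supremum is over all functions $L(P)\in[0,\infty]$ with $\lim_{P\to\infty}L(P)/\log_2P=\alpha$ and all families of rate tuples $(R_k(P))_{k}$ such that, for each $P>0$, the tuple $(R_k(P))_k$ is achievable with power $P$ under the backhaul constraint $L(P)$. Then $$\mathsf{DoF}^*(\alpha)\le\min\Big\{1,\frac{1+\alpha}{2}\Big\}.$$ -/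

import Mathlib

open MeasureTheory ProbabilityTheory Filter Topology
open scoped ENNReal

namespace InterferenceChannel

noncomputable section

/-- The law of a circularly-symmetric complex Gaussian variable with zero mean and unit variance:
real and imaginary part are independent real Gaussians of mean `0` and variance `1/2`. -/
def complexGaussian : Measure ℂ :=
  ((gaussianReal 0 (1 / 2)).prod (gaussianReal 0 (1 / 2))).map
    Complex.measurableEquivRealProd.symm

/-- Shannon entropy, in bits, of a random variable with values in a finite set. -/
def entropy {Ω A : Type*} [MeasurableSpace Ω] [Fintype A] (μ : Measure Ω) (X : Ω → A) : ℝ :=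
  ∑ a, Real.negMulLog (μ.real (X ⁻¹' {a})) / Real.log 2

/-- A coding scheme of block length `n` for `K` users, with `M i` messages for user `i`, power
constraint `P`, and interactive cooperation of the receivers over noiseless directed links.

The link from receiver `i` to receiver `j ≠ i` carries one symbol of the finite alphabet
`Fin (b i j)` per time slot. The diagonal entries `j = i` stand for no link: they never reach any
receiver and never enter the backhaul rate. -/
structure Scheme (K n : ℕ) (M : Fin K → ℕ) (P : ℝ) where
  /-- The codeword of each message. -/
  enc : ∀ i, Fin (M i) → Fin n → ℂ
  power : ∀ i w, (1 / (n : ℝ)) * ∑ t, ‖enc i w t‖ ^ 2 ≤ P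
  /-- The alphabet sizes of the links. -/
  b : Fin K → Fin K → ℕ
  /-- The symbol sent by `i` to `j` at time `t`, given what `i` observed on the channel and what it
  received from the other receivers at the times before `t`. -/
  relay : ∀ (i j : Fin K) (t : Fin n),
    (Fin t → ℂ) × (∀ l : {l : Fin K // l ≠ i}, Fin t → Fin (b l i)) → Fin (b i j)
  measurable_relay : ∀ i j t, Measurable (relay i j t)
  /-- The decision of receiver `i`, given its channel observations and all that it received from
  the other receivers. -/
  dec : ∀ i : Fin K,
    (Fin n → ℂ) × (∀ l : {l : Fin K // l ≠ i}, Fin n → Fin (b l i)) → Fin (M i)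
  measurable_dec : ∀ i, Measurable (dec i)

namespace Scheme

variable {K n : ℕ} {M : Fin K → ℕ} {P : ℝ}

/-- The backhaul symbol `m_{i → j}(t)` when the receivers observe the signals `y`. -/
def msg (c : Scheme K n M P) (y : Fin K → Fin n → ℂ) (t : Fin n) (i j : Fin K) :
    Fin (c.b i j) :=
  c.relay i j t
    (fun τ => y i (Fin.castLE t.isLt.le τ),
      fun l τ => c.msg y (Fin.castLE t.isLt.le τ) l i)
termination_by t.val
decreasing_by exact τ.isLt

/-- The message estimate of receiver `i` when the receivers observe the signals `y`. -/
def decoded (c : Scheme K n M P) (y : Fin K → Fin n → ℂ) (i : Fin K) : Fin (M i) :=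
  c.dec i (y i, fun l τ => c.msg y τ l i)

end Scheme

/-- An outcome: the messages of all users and the noise at each receiver and time. -/
abbrev Outcome (K n : ℕ) (M : Fin K → ℕ) : Type :=
  (∀ i, Fin (M i)) × (Fin K → Fin n → ℂ)

/-- The messages are uniform, the noise samples are standard complex Gaussian, and all of them are
independent. -/
def law (K n : ℕ) (M : Fin K → ℕ) : Measure (Outcome K n M) :=
  (Measure.pi fun i => uniformOn (Set.univ : Set (Fin (M i)))).prod
    (Measure.pi fun _ => Measure.pi fun _ => complexGaussian)

namespace Scheme

variable {K n : ℕ} {M : Fin K → ℕ} {P : ℝ}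

/-- The received signals `y_i(t) = ∑ j, h_{ij} x_j(t) + z_i(t)`. -/
def received (c : Scheme K n M P) (h : Matrix (Fin K) (Fin K) ℂ) (ω : Outcome K n M)
    (i : Fin K) (t : Fin n) : ℂ :=
  ∑ j, h i j * c.enc j (ω.1 j) t + ω.2 i t

/-- The probability that some user's message is decoded wrongly. -/
def errorProb (c : Scheme K n M P) (h : Matrix (Fin K) (Fin K) ℂ) : ℝ :=
  (law K n M).real {ω | ∃ i, c.decoded (c.received h ω) i ≠ ω.1 i}

/-- The rate of the link from `i` to `j`: the joint entropy of its symbols, per channel use. -/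
def linkRate (c : Scheme K n M P) (h : Matrix (Fin K) (Fin K) ℂ) (i j : Fin K) : ℝ :=
  (1 / (n : ℝ)) *
    entropy (law K n M) fun ω => fun t : Fin n => c.msg (c.received h ω) t i j

/-- The average backhaul cooperation rate per user. -/
def backhaulRate (c : Scheme K n M P) (h : Matrix (Fin K) (Fin K) ℂ) : ℝ :=
  (1 / (K : ℝ)) * ∑ i, ∑ j ∈ Finset.univ.filter (fun j => j ≠ i), c.linkRate h i j

end Scheme

/-- The rate tuple `R` (in bits per channel use) is achievable with power `P` under the average
backhaul rate constraint `L`, where `L = ∞` means no constraint. -/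
def Achievable {K : ℕ} (h : Matrix (Fin K) (Fin K) ℂ) (P : ℝ) (L : ℝ≥0∞) (R : Fin K → ℝ) :
    Prop :=
  (∀ i, 0 ≤ R i) ∧
    ∀ ε : ℝ, 0 < ε → ∃ N : ℕ, ∀ n ≥ N,
      ∃ c : Scheme K n (fun i => ⌊(2 : ℝ) ^ ((n : ℝ) * R i)⌋₊) P,
        c.errorProb h < ε ∧ ENNReal.ofReal (c.backhaulRate h) ≤ L

/-- The average degrees of freedom per user of a family of rate tuples indexed by the power. -/
def dof {K : ℕ} (R : ℝ → Fin K → ℝ) : ℝ≥0∞ :=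
  liminf (fun P : ℝ => ENNReal.ofReal ((∑ k, R P k) / (K * Real.logb 2 P))) atTop

/-- The average degrees of freedom per user of the channel with gains `h` at average backhaul load
`α`: the supremum over all backhaul constraints `L(P)` with `L(P) / log P → α` and all rates that
are achievable under them. -/
def dofStar {K : ℕ} (h : Matrix (Fin K) (Fin K) ℂ) (α : ℝ≥0∞) : ℝ≥0∞ :=
  sSup {d | ∃ (L : ℝ → ℝ≥0∞) (R : ℝ → Fin K → ℝ),
    Tendsto (fun P : ℝ => L P / ENNReal.ofReal (Real.logb 2 P)) atTop (𝓝 α) ∧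
    (∀ P > 0, Achievable h P (L P) (R P)) ∧ d = dof R}

end

end InterferenceChannel

/-!
The proof compares densities, without differential entropy. Fix a scheme, and call `p(y | w)` the
density of all the received signals `y` when the messages `w` are sent. Decoding is a function of
`y`, so the probability that all messages are decoded correctly, while the received signals lie in
a set `A`, is the integral of `p(y | decoded y)` over `A`, divided by the number of message tuples
(`Scheme.law_correct`). Any density that dominates `p(y | decoded y)`, up to a factor, thus bounds
the number of messages.

For the bound `1`, a codeword of power `P` in unit noise is dominated, at each receiver, by a
centred Gaussian of variance `1 + P`, up to a constant factor per channel use. Hence the sum rate is at most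
`K log P + O(1)` (`Achievable.sum_le`).

For the bound `(1 + α) / 2`, let `a' = a + 1`. Receiver `a'` knows `y a'` and the symbols `s` that
it gets from the others, which yield its message. Given also the messages of the users other than
`a` and `a'`, only the codeword of `a` is unknown, and since `h a' a ≠ 0`, the signal `y a'` shows
it up to noise of bounded variance. All the other signals are then predicted up to noise of bounded
variance. So `p(y | decoded y)` is dominated by a centred Gaussian of variance of order `P` at `a'`
times Gaussians of bounded variance around these predictions, summed over the possible `s`
(`Scheme.mul_law_correct_le`). The symbols `s` are restricted to a set of typical values, whose
number is controlled by the entropies of the links through Markov's inequality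
(`exists_typical_set`). The result is `R a + R a' ≤ log P + (backhaul rate into a') + O(1)`; summed
over the cycle of users it bounds twice the sum rate by `K log P + K L + O(1)`
(`Achievable.two_mul_sum_le`).

Markov's inequality costs a factor `r > 1` in the entropy. Since the error probability can be made
smaller than `1 - 1 / r`, block lengths tend to infinity first and `r` tends to `1` afterwards.
-/

/-! ### Products of densities and Gaussian integrals -/

namespace MeasureTheory

/-- Tonelli's theorem for a product of functions of one coordinate each, indexed by `Fin n`. -/
theorem lintegral_fin_prod_eq_prod {n : ℕ} {E : Fin n → Type*}
    {mE : ∀ i, MeasurableSpace (E i)} {μ : (i : Fin n) → Measure (E i)} [∀ i, SigmaFinite (μ i)]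
    {f : (i : Fin n) → E i → ℝ≥0∞} (hf : ∀ i, Measurable (f i)) :
    ∫⁻ x : (i : Fin n) → E i, ∏ i, f i (x i) ∂(Measure.pi μ) = ∏ i, ∫⁻ x, f i x ∂(μ i) := by
  induction n with
  | zero => simp
  | succ n ih =>
    have hm : Measurable fun x : (i : Fin n) → E (Fin.succAbove 0 i) =>
        ∏ i : Fin n, f (Fin.succAbove 0 i) (x i) :=
      Finset.measurable_prod _ fun i _ => (hf _).comp (measurable_pi_apply i)
    rw [Fin.prod_univ_succAbove _ 0, ← ih fun i => hf _,
      ← lintegral_prod_mul (hf 0).aemeasurable hm.aemeasurable,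
      ← (measurePreserving_piFinSuccAbove μ 0).lintegral_comp_emb
        (MeasurableEquiv.measurableEmbedding _)]
    refine lintegral_congr fun x => ?_
    rw [Fin.prod_univ_succAbove _ 0]
    rfl

/-- Tonelli's theorem for a product of functions of one coordinate each. -/
theorem lintegral_fintype_prod_eq_prod {ι : Type*} [Fintype ι] {E : ι → Type*}
    {mE : ∀ i, MeasurableSpace (E i)} {μ : (i : ι) → Measure (E i)} [∀ i, SigmaFinite (μ i)]
    {f : (i : ι) → E i → ℝ≥0∞} (hf : ∀ i, Measurable (f i)) :
    ∫⁻ x : (i : ι) → E i, ∏ i, f i (x i) ∂(Measure.pi μ) = ∏ i, ∫⁻ x, f i x ∂(μ i) := by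
  let e := (Fintype.equivFin ι).symm
  rw [(measurePreserving_piCongrLeft _ e).lintegral_map_equiv]
  simp_rw [← e.prod_comp, MeasurableEquiv.coe_piCongrLeft, Equiv.piCongrLeft_apply_apply]
  exact lintegral_fin_prod_eq_prod fun i => hf _

/-- A product of measures with densities has the product density. -/
theorem Measure.pi_withDensity {ι : Type*} [Fintype ι] {E : ι → Type*}
    {mE : ∀ i, MeasurableSpace (E i)} {μ : (i : ι) → Measure (E i)} [∀ i, SigmaFinite (μ i)]
    {f : (i : ι) → E i → ℝ≥0∞} (hf : ∀ i, Measurable (f i))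
    [∀ i, SigmaFinite ((μ i).withDensity (f i))] :
    Measure.pi (fun i => (μ i).withDensity (f i)) =
      (Measure.pi μ).withDensity fun x => ∏ i, f i (x i) := by
  refine Measure.pi_eq fun s hs => ?_
  rw [withDensity_apply _ (MeasurableSet.univ_pi hs), ← lintegral_indicator (.univ_pi hs)]
  have (x : (i : ι) → E i) : (Set.univ.pi s).indicator (fun x => ∏ i, f i (x i)) x =
      ∏ i, (s i).indicator (f i) (x i) := by
    by_cases h : ∀ i, x i ∈ s i
    · rw [Set.indicator_of_mem (by simpa using h)]
      exact Finset.prod_congr rfl fun i _ => (Set.indicator_of_mem (h i) _).symm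
    · rw [Set.indicator_of_notMem (by simpa using h)]
      obtain ⟨i, hi⟩ := not_forall.1 h
      exact (Finset.prod_eq_zero (Finset.mem_univ i) (Set.indicator_of_notMem hi _)).symm
  simp_rw [this]
  rw [lintegral_fintype_prod_eq_prod fun i => (hf i).indicator (hs i)]
  refine Finset.prod_congr rfl fun i _ => ?_
  rw [lintegral_indicator (hs i), withDensity_apply _ (hs i)]

end MeasureTheory

namespace InterferenceChannel

/-- The energy `∑ t, |v t|²` of a block of complex symbols. -/
noncomputable def energy {ι : Type*} [Fintype ι] (v : ι → ℂ) : ℝ := ∑ t, ‖v t‖ ^ 2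

section Energy

variable {ι : Type*} [Fintype ι]

lemma energy_nonneg (v : ι → ℂ) : 0 ≤ energy v := Finset.sum_nonneg fun _ _ => by positivity

@[fun_prop]
lemma measurable_energy : Measurable (energy : (ι → ℂ) → ℝ) := by
  unfold energy; fun_prop

lemma ofReal_exp_sum {κ : Type*} (s : Finset κ) (f : κ → ℝ) :
    ENNReal.ofReal (Real.exp (∑ i ∈ s, f i)) = ∏ i ∈ s, ENNReal.ofReal (Real.exp (f i)) := by
  rw [Real.exp_sum, ENNReal.ofReal_prod_of_nonneg fun _ _ => (Real.exp_pos _).le]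

lemma lintegral_exp_neg_mul_normSq {β : ℝ} (hβ : 0 < β) :
    ∫⁻ z : ℂ, ENNReal.ofReal (Real.exp (-β * ‖z‖ ^ 2)) = ENNReal.ofReal (Real.pi / β) := by
  have h := GaussianFourier.integral_rexp_neg_mul_sq_norm (V := ℂ) hβ
  rw [Complex.finrank_real_complex] at h
  norm_num at h
  rw [← ofReal_integral_eq_lintegral_ofReal, ← h]
  · simp
  · refine Integrable.of_integral_ne_zero ?_
    simp only [neg_mul]
    rw [h]; positivity
  · exact ae_of_all _ fun _ => (Real.exp_pos _).le

lemma lintegral_exp_neg_mul_energy {β : ℝ} (hβ : 0 < β) :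
    ∫⁻ v : ι → ℂ, ENNReal.ofReal (Real.exp (-β * energy v)) =
      ENNReal.ofReal (Real.pi / β) ^ Fintype.card ι := by
  simp_rw [energy, Finset.mul_sum, ofReal_exp_sum]
  rw [volume_pi, lintegral_fintype_prod_eq_prod
    (f := fun _ z => ENNReal.ofReal (Real.exp (-β * ‖z‖ ^ 2))) (fun _ => by fun_prop)]
  simp_rw [lintegral_exp_neg_mul_normSq hβ]
  simp

lemma lintegral_exp_neg_mul_sum_energy {κ : Type*} [Fintype κ] {β : ℝ} (hβ : 0 < β) :
    ∫⁻ v : κ → ι → ℂ, ENNReal.ofReal (Real.exp (-β * ∑ j, energy (v j))) =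
      ENNReal.ofReal (Real.pi / β) ^ (Fintype.card κ * Fintype.card ι) := by
  simp_rw [Finset.mul_sum, ofReal_exp_sum]
  rw [volume_pi, lintegral_fintype_prod_eq_prod
    (f := fun _ v => ENNReal.ofReal (Real.exp (-β * energy v))) (fun _ => by fun_prop)]
  simp_rw [lintegral_exp_neg_mul_energy hβ]
  simp [← pow_mul, mul_comm]

end Energy

lemma complexGaussian_eq_withDensity :
    complexGaussian = volume.withDensity fun z : ℂ =>
      ENNReal.ofReal Real.pi⁻¹ * ENNReal.ofReal (Real.exp (-‖z‖ ^ 2)) := by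
  have h2 : (1 / 2 : NNReal) ≠ 0 := by norm_num
  rw [complexGaussian, gaussianReal_of_var_ne_zero _ h2,
    prod_withDensity (measurable_gaussianPDF _ _) (measurable_gaussianPDF _ _)]
  ext s hs
  rw [Measure.map_apply Complex.measurableEquivRealProd.symm.measurable hs,
    withDensity_apply _ (Complex.measurableEquivRealProd.symm.measurable hs),
    withDensity_apply _ hs,
    ← Complex.volume_preserving_equiv_real_prod.symm.setLIntegral_comp_preimage_emb
      (MeasurableEquiv.measurableEmbedding _)]
  refine lintegral_congr fun p => ?_
  have hpi : (√(2 * Real.pi * ((1 / 2 : NNReal) : ℝ)))⁻¹ *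
      (√(2 * Real.pi * ((1 / 2 : NNReal) : ℝ)))⁻¹
      = Real.pi⁻¹ := by
    rw [← mul_inv, Real.mul_self_sqrt (by positivity)]
    congr 1; push_cast; ring
  simp only [gaussianPDF, gaussianPDFReal]
  rw [← ENNReal.ofReal_mul (by positivity), ← ENNReal.ofReal_mul (by positivity), mul_mul_mul_comm,
    hpi, ← Real.exp_add, Complex.sq_norm, Complex.normSq_apply,
    Complex.measurableEquivRealProd_symm_apply]
  congr 3
  push_cast
  ring

instance : IsProbabilityMeasure complexGaussian := by
  rw [complexGaussian]
  exact Measure.isProbabilityMeasure_map (MeasurableEquiv.measurable _).aemeasurable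

lemma pi_complexGaussian (κ ι : Type*) [Fintype κ] [Fintype ι] :
    (Measure.pi fun _ : κ => Measure.pi fun _ : ι => complexGaussian) =
      volume.withDensity fun z : κ → ι → ℂ =>
        ENNReal.ofReal Real.pi⁻¹ ^ (Fintype.card κ * Fintype.card ι) *
          ENNReal.ofReal (Real.exp (-∑ j, energy (z j))) := by
  let f : ℂ → ℝ≥0∞ := fun z => ENNReal.ofReal Real.pi⁻¹ * ENNReal.ofReal (Real.exp (-‖z‖ ^ 2))
  have hf : Measurable f := by fun_prop
  have h0 : complexGaussian = volume.withDensity f := complexGaussian_eq_withDensity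
  have h1 : (Measure.pi fun _ : ι => complexGaussian) =
      volume.withDensity fun z : ι → ℂ => ∏ t, f (z t) := by
    have : SigmaFinite ((volume : Measure ℂ).withDensity f) := by rw [← h0]; infer_instance
    rw [h0, Measure.pi_withDensity (μ := fun _ : ι => volume) (f := fun _ => f) fun _ => hf,
      volume_pi]
  have : SigmaFinite ((volume : Measure (ι → ℂ)).withDensity fun z => ∏ t, f (z t)) := by
    rw [← h1]; infer_instance
  rw [h1, Measure.pi_withDensity (μ := fun _ : κ => volume) (f := fun _ (z : ι → ℂ) => ∏ t, f (z t))
    fun _ => by fun_prop, ← volume_pi]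
  congr 1
  ext z
  simp_rw [energy, ← Finset.sum_neg_distrib, ofReal_exp_sum, f, Finset.prod_mul_distrib]
  simp [← pow_mul, mul_comm]

/-! ### Typical values of finite-valued random variables -/

section Typical

variable {Ω : Type*} [MeasurableSpace Ω] {μ : Measure Ω} [IsProbabilityMeasure μ]

lemma entropy_nonneg {A : Type*} [Fintype A] (X : Ω → A) : 0 ≤ entropy μ X :=
  Finset.sum_nonneg fun _ _ => div_nonneg
    (Real.negMulLog_nonneg measureReal_nonneg measureReal_le_one) (Real.log_nonneg (by norm_num))

lemma measure_measureReal_eq_zero {A : Type*} [Finite A] (X : Ω → A) :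
    μ {ω | μ.real (X ⁻¹' {X ω}) = 0} = 0 := by
  refine measure_mono_null (t := ⋃ a ∈ {a | μ.real (X ⁻¹' {a}) = 0}, X ⁻¹' {a}) ?_ ?_
  · intro ω hω
    simpa using hω
  · refine (measure_biUnion_null_iff (Set.to_countable _)).2 fun a ha => ?_
    simpa [measureReal_eq_zero_iff] using ha

variable {A : Type*} [Fintype A] [MeasurableSpace A] [MeasurableSingletonClass A]

/-- The entropy is the mean of the information content `-log P(X)`. -/
lemma integral_neg_log_measureReal {X : Ω → A} (hX : Measurable X) :
    ∫ ω, -Real.log (μ.real (X ⁻¹' {X ω})) ∂μ = entropy μ X * Real.log 2 := by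
  have h := integral_map (μ := μ) hX.aemeasurable
    (f := fun a => -Real.log (μ.real (X ⁻¹' {a})))
    Measurable.of_discrete.aestronglyMeasurable
  rw [← h, integral_fintype .of_finite, entropy, Finset.sum_mul]
  refine Finset.sum_congr rfl fun a _ => ?_
  rw [map_measureReal_apply hX (measurableSet_singleton a), smul_eq_mul, Real.negMulLog]
  field_simp

/-- Finitely many random variables with values in finite sets and total entropy `H` nats take,
jointly, all but a fraction `1 / r` of their values in a set of at most `exp (r (H + 1))`
elements. A value is put into the set when the product of its marginal probabilities is at least
`exp (-r (H + 1))`; these products sum to one, and Markov's inequality for the information content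
bounds the probability of the other values. The summand `1` makes the bound valid for `H = 0`. -/
theorem exists_typical_set {ι : Type*} [Fintype ι] {A : ι → Type*} [∀ j, Fintype (A j)]
    [∀ j, MeasurableSpace (A j)] [∀ j, MeasurableSingletonClass (A j)]
    {X : ∀ j, Ω → A j} (hX : ∀ j, Measurable (X j)) {r : ℝ} (hr : 0 < r) :
    ∃ S : Finset (∀ j, A j),
      (S.card : ℝ) ≤ Real.exp (r * ((∑ j, entropy μ (X j)) * Real.log 2 + 1)) ∧
        μ {ω | (fun j => X j ω) ∉ S} ≤ ENNReal.ofReal (1 / r) := by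
  classical
  set H := (∑ j, entropy μ (X j)) * Real.log 2 with hH
  have hH0 : 0 ≤ H := mul_nonneg (Finset.sum_nonneg fun j _ => entropy_nonneg _)
    (Real.log_nonneg (by norm_num))
  have hc : 0 < r * (H + 1) := by positivity
  let p : ∀ j, A j → ℝ := fun j a => μ.real (X j ⁻¹' {a})
  have hp0 : ∀ j a, 0 ≤ p j a := fun j a => measureReal_nonneg
  have hp1 : ∀ j, ∑ a, p j a = 1 := fun j => by
    simp only [p]
    rw [sum_measureReal_preimage_singleton _ fun a _ => hX j (measurableSet_singleton a)]
    simp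
  refine ⟨Finset.univ.filter fun b : ∀ j, A j => Real.exp (-(r * (H + 1))) ≤ ∏ j, p j (b j), ?_, ?_⟩
  · set S := Finset.univ.filter fun b : ∀ j, A j => Real.exp (-(r * (H + 1))) ≤ ∏ j, p j (b j)
    have h1 : ∑ b : ∀ j, A j, ∏ j, p j (b j) = 1 := by
      rw [← Fintype.prod_sum]; simp [hp1]
    have h2 : (S.card : ℝ) * Real.exp (-(r * (H + 1))) ≤ 1 := by
      rw [← nsmul_eq_mul]
      refine le_trans ?_ h1.le
      refine (Finset.card_nsmul_le_sum S _ _ fun b hb => (Finset.mem_filter.1 hb).2).trans ?_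
      exact Finset.sum_le_univ_sum_of_nonneg fun b => Finset.prod_nonneg fun j _ => hp0 _ _
    rw [Real.exp_neg, ← div_eq_mul_inv, div_le_one (Real.exp_pos _)] at h2
    exact h2
  · let T : Ω → ℝ := fun ω => ∑ j, -Real.log (p j (X j ω))
    have hint : ∀ j, Integrable (fun ω => -Real.log (p j (X j ω))) μ := fun j =>
      (Integrable.of_finite (μ := μ.map (X j)) (f := fun a => -Real.log (p j a))).comp_measurable
        (hX j)
    have hT : ∫ ω, T ω ∂μ = H := by
      rw [integral_finsetSum _ fun j _ => hint j, hH, Finset.sum_mul]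
      exact Finset.sum_congr rfl fun j _ => integral_neg_log_measureReal (hX j)
    have hTint : Integrable T μ := integrable_finsetSum _ fun j _ => hint j
    have hT0 : 0 ≤ᵐ[μ] T := ae_of_all _ fun ω => Finset.sum_nonneg fun j _ =>
      neg_nonneg.2 (Real.log_nonpos (hp0 _ _) measureReal_le_one)
    have hM := mul_meas_ge_le_integral_of_nonneg hT0 hTint (r * (H + 1))
    have hM' : μ.real {ω | r * (H + 1) ≤ T ω} ≤ 1 / r := by
      rw [hT] at hM
      have h3 : r * μ.real {ω | r * (H + 1) ≤ T ω} * (H + 1) ≤ 1 * (H + 1) := by linarith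
      rw [le_div_iff₀ hr, mul_comm]
      exact le_of_mul_le_mul_right h3 (by linarith)
    have hnull : μ (⋃ j, {ω | p j (X j ω) = 0}) = 0 :=
      measure_iUnion_null fun j => measure_measureReal_eq_zero (X j)
    calc μ _ ≤ μ ({ω | r * (H + 1) ≤ T ω} ∪ ⋃ j, {ω | p j (X j ω) = 0}) := by
          refine measure_mono fun ω hω => ?_
          by_contra hcon
          simp only [Set.mem_union, Set.mem_ofPred_eq, Set.mem_iUnion, not_or, not_exists,
            not_le] at hcon
          obtain ⟨hlt, hne⟩ := hcon
          refine hω ?_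
          simp only [Finset.mem_filter, Finset.mem_univ, true_and]
          rw [← Real.exp_log (Finset.prod_pos fun j _ =>
            lt_of_le_of_ne (hp0 j (X j ω)) (Ne.symm (hne j))),
            Real.exp_le_exp, Real.log_prod fun j _ => hne j]
          simp only [T, Finset.sum_neg_distrib] at hlt
          linarith
      _ ≤ μ {ω | r * (H + 1) ≤ T ω} + 0 := (measure_union_le _ _).trans (by rw [hnull])
      _ ≤ ENNReal.ofReal (1 / r) := by
          rw [add_zero, ← ofReal_measureReal]
          exact ENNReal.ofReal_le_ofReal hM'

end Typical

/-! ### The probability of correct decoding -/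

namespace Scheme

variable {K n : ℕ} {M : Fin K → ℕ} {P : ℝ}

lemma measurable_msg (c : Scheme K n M P) (t : Fin n) (i j : Fin K) :
    Measurable fun y : Fin K → Fin n → ℂ => c.msg y t i j := by
  suffices H : ∀ (m : ℕ) (t : Fin n), t.val = m → ∀ i j,
      Measurable fun y : Fin K → Fin n → ℂ => c.msg y t i j from H _ t rfl i j
  intro m
  induction m using Nat.strong_induction_on with
  | _ m ih =>
    intro t ht i j
    have : (fun y => c.msg y t i j) = fun y => c.relay i j t
        (fun τ => y i (Fin.castLE t.isLt.le τ),
          fun l τ => c.msg y (Fin.castLE t.isLt.le τ) l i) := by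
      ext y; rw [msg]
    rw [this]
    refine (c.measurable_relay i j t).comp (Measurable.prodMk (by fun_prop) ?_)
    refine measurable_pi_lambda _ fun l => measurable_pi_lambda _ fun τ => ?_
    exact ih τ (ht ▸ τ.isLt) _ rfl _ _

/-- All the symbols that receiver `i` obtains from the other receivers. -/
def incoming (c : Scheme K n M P) (y : Fin K → Fin n → ℂ) (i : Fin K) :
    ∀ l : {l : Fin K // l ≠ i}, Fin n → Fin (c.b l i) :=
  fun l τ => c.msg y τ l i

lemma measurable_incoming (c : Scheme K n M P) (i : Fin K) :
    Measurable fun y => c.incoming y i :=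
  measurable_pi_lambda _ fun _ => measurable_pi_lambda _ fun _ => c.measurable_msg _ _ _

lemma measurable_decoded (c : Scheme K n M P) : Measurable c.decoded :=
  measurable_pi_lambda _ fun i => (c.measurable_dec i).comp
    (Measurable.prodMk (measurable_pi_apply i) (c.measurable_incoming i))

/-- The noiseless part of the received signals when the messages `w` are sent. -/
def signal (c : Scheme K n M P) (h : Matrix (Fin K) (Fin K) ℂ) (w : ∀ i, Fin (M i)) :
    Fin K → Fin n → ℂ :=
  fun i t => ∑ j, h i j * c.enc j (w j) t

lemma received_eq (c : Scheme K n M P) (h : Matrix (Fin K) (Fin K) ℂ) (ω : Outcome K n M) :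
    c.received h ω = c.signal h ω.1 + ω.2 := rfl

lemma measurable_received (c : Scheme K n M P) (h : Matrix (Fin K) (Fin K) ℂ) :
    Measurable (c.received h) := by
  have : Measurable (c.signal h) := measurable_of_finite _
  exact (this.comp measurable_fst).add measurable_snd

/-- The density of the noise `z` of all the receivers with respect to Lebesgue measure. -/
noncomputable def noiseDensity (z : Fin K → Fin n → ℂ) : ℝ≥0∞ :=
  ENNReal.ofReal Real.pi⁻¹ ^ (K * n) * ENNReal.ofReal (Real.exp (-∑ j, energy (z j)))

@[fun_prop]
lemma measurable_noiseDensity : Measurable (noiseDensity : (Fin K → Fin n → ℂ) → ℝ≥0∞) := by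
  unfold noiseDensity; fun_prop

lemma isProbabilityMeasure_law (hM : ∀ i, 0 < M i) : IsProbabilityMeasure (law K n M) := by
  have : ∀ i, Nonempty (Fin (M i)) := fun i => ⟨⟨0, hM i⟩⟩
  rw [law]
  infer_instance

/-- The probability that all messages are decoded correctly while the received signals lie in `A`.
Given the received signals `y`, only the messages `c.decoded y` contribute. -/
lemma law_correct (hM : ∀ i, 0 < M i) (c : Scheme K n M P) (h : Matrix (Fin K) (Fin K) ℂ)
    {A : Set (Fin K → Fin n → ℂ)} (hA : MeasurableSet A) :
    law K n M {ω | c.received h ω ∈ A ∧ c.decoded (c.received h ω) = ω.1} =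
      (∏ i, (M i : ℝ≥0∞))⁻¹ * ∫⁻ y in A, noiseDensity (y - c.signal h (c.decoded y)) := by
  have : ∀ i, Nonempty (Fin (M i)) := fun i => ⟨⟨0, hM i⟩⟩
  have hmeas : MeasurableSet
      {ω : Outcome K n M | c.received h ω ∈ A ∧ c.decoded (c.received h ω) = ω.1} :=
    (c.measurable_received h hA).inter
      (measurableSet_eq_fun (c.measurable_decoded.comp (c.measurable_received h)) measurable_fst)
  have hsing : ∀ w : ∀ i, Fin (M i),
      (Measure.pi fun i => uniformOn (Set.univ : Set (Fin (M i)))) {w} =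
        (∏ i, (M i : ℝ≥0∞))⁻¹ := fun w => by
    rw [Measure.pi_singleton, ENNReal.prod_inv_distrib]
    · exact Finset.prod_congr rfl fun i _ => by simp [uniformOn_univ]
    · intro i _ j _ _; right; simp
  have hfib : ∀ w : ∀ i, Fin (M i),
      (Measure.pi fun _ : Fin K => Measure.pi fun _ : Fin n => complexGaussian)
        (Prod.mk w ⁻¹' {ω : Outcome K n M | c.received h ω ∈ A ∧
          c.decoded (c.received h ω) = ω.1}) =
      ∫⁻ y in A, (c.decoded ⁻¹' {w}).indicator (fun y => noiseDensity (y - c.signal h w)) y := by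
    intro w
    have hm := measurable_prodMk_left (x := w) hmeas
    rw [pi_complexGaussian, withDensity_apply _ hm, ← lintegral_indicator hm,
      ← lintegral_indicator hA]
    conv_rhs => rw [← lintegral_add_left_eq_self _ (c.signal h w)]
    refine lintegral_congr fun z => ?_
    by_cases h1 : c.signal h w + z ∈ A
    · by_cases h2 : c.decoded (c.signal h w + z) = w
      · simp [Set.indicator, received_eq, h1, h2, noiseDensity]
      · simp [Set.indicator, received_eq, h1, h2]
    · simp [Set.indicator, received_eq, h1]
  rw [law, Measure.prod_apply hmeas, lintegral_fintype]
  simp_rw [hsing, hfib]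
  rw [← Finset.sum_mul, mul_comm, ← lintegral_finsetSum]
  · congr 1
    refine lintegral_congr fun y => ?_
    rw [Finset.sum_eq_single (c.decoded y)]
    · simp
    · intro w _ hw
      simp [Set.indicator, hw.symm]
    · simp
  · intro w _
    exact (by fun_prop : Measurable fun y => noiseDensity (y - c.signal h w)).indicator
      (c.measurable_decoded (measurableSet_singleton w))

end Scheme

/-! ### Energy estimates -/

section Energy

variable {ι : Type*} [Fintype ι]

lemma energy_add_le (u v : ι → ℂ) {P : ℝ} (hP : 0 < P) :
    (1 + P)⁻¹ * energy (u + v) ≤ energy u + energy v / P := by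
  rw [inv_mul_le_iff₀ (by positivity), energy, energy, energy, Finset.sum_div,
    ← Finset.sum_add_distrib, Finset.mul_sum]
  refine Finset.sum_le_sum fun t _ => ?_
  have h1 : ‖(u + v) t‖ ^ 2 ≤ (‖u t‖ + ‖v t‖) ^ 2 :=
    pow_le_pow_left₀ (norm_nonneg _) (norm_add_le _ _) 2
  have h2 : (1 + P) * (‖u t‖ ^ 2 + ‖v t‖ ^ 2 / P) - (‖u t‖ + ‖v t‖) ^ 2 =
      (P * ‖u t‖ - ‖v t‖) ^ 2 / P := by field_simp; ring
  have h3 : 0 ≤ (P * ‖u t‖ - ‖v t‖) ^ 2 / P := by positivity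
  linarith

lemma energy_sub_smul_le (u v : ι → ℂ) (r : ℂ) :
    energy (u - r • v) ≤ 2 * energy u + 2 * ‖r‖ ^ 2 * energy v := by
  rw [energy, energy, energy, Finset.mul_sum, Finset.mul_sum, ← Finset.sum_add_distrib]
  refine Finset.sum_le_sum fun t _ => ?_
  have h1 : ‖(u - r • v) t‖ ^ 2 ≤ (‖u t‖ + ‖r‖ * ‖v t‖) ^ 2 := by
    refine pow_le_pow_left₀ (norm_nonneg _) ?_ 2
    rw [← norm_mul]
    exact norm_sub_le _ _
  nlinarith [sq_nonneg (‖u t‖ - ‖r‖ * ‖v t‖)]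

end Energy

/-- A bound on the factor by which the average power of the noiseless signal at receiver `i` exceeds
the power of the transmitters. The factor `K` comes from bounding the sum of the transmitted
powers. -/
noncomputable def gain {K : ℕ} (h : Matrix (Fin K) (Fin K) ℂ) (i : Fin K) : ℝ :=
  K * ∑ j, ‖h i j‖ ^ 2

/-- A constant factor small enough that this multiple of the energy of the residuals, together with
half of the noise energy of receiver `a'`, is at most the total noise energy. -/
noncomputable def residualShare {K : ℕ} (h : Matrix (Fin K) (Fin K) ℂ) (a a' : Fin K) : ℝ :=
  (4 + 4 * ∑ j, ‖h j a / h a' a‖ ^ 2)⁻¹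

lemma residualShare_pos {K : ℕ} (h : Matrix (Fin K) (Fin K) ℂ) (a a' : Fin K) :
    0 < residualShare h a a' :=
  inv_pos.2 (add_pos_of_pos_of_nonneg four_pos
    (mul_nonneg zero_le_four (Finset.sum_nonneg fun _ _ => by positivity)))

namespace Scheme

variable {K n : ℕ} {M : Fin K → ℕ} {P : ℝ}

lemma energy_enc_le (c : Scheme K n M P) (i : Fin K) (w : Fin (M i)) :
    energy (c.enc i w) ≤ n * P := by
  rcases Nat.eq_zero_or_pos n with rfl | hn
  · simp [energy]
  · have h := c.power i w
    rwa [one_div, inv_mul_le_iff₀ (by exact_mod_cast hn)] at h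

lemma energy_signal_le (c : Scheme K n M P) (h : Matrix (Fin K) (Fin K) ℂ) (w : ∀ i, Fin (M i))
    (i : Fin K) : energy (c.signal h w i) ≤ n * gain h i * P := by
  have h1 : energy (c.signal h w i) ≤
      (∑ j, ‖h i j‖ ^ 2) * ∑ j, energy (c.enc j (w j)) := by
    simp only [energy, signal]
    rw [Finset.sum_comm (f := fun j t => ‖c.enc j (w j) t‖ ^ 2), Finset.mul_sum]
    refine Finset.sum_le_sum fun t _ => ?_
    calc ‖∑ j, h i j * c.enc j (w j) t‖ ^ 2
        ≤ (∑ j, ‖h i j‖ * ‖c.enc j (w j) t‖) ^ 2 := by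
          refine pow_le_pow_left₀ (norm_nonneg _) ((norm_sum_le _ _).trans_eq ?_) 2
          simp
      _ ≤ _ := Finset.sum_mul_sq_le_sq_mul_sq _ _ _
  have h2 : ∑ j, energy (c.enc j (w j)) ≤ K * (n * P) := by
    refine (Finset.sum_le_sum fun j _ => c.energy_enc_le j (w j)).trans_eq ?_
    simp
  calc _ ≤ (∑ j, ‖h i j‖ ^ 2) * (K * (n * P)) :=
        h1.trans (mul_le_mul_of_nonneg_left h2 (Finset.sum_nonneg fun _ _ => by positivity))
    _ = _ := by rw [gain]; ring

/-- The density of a received signal around its noiseless part is at most a centred Gaussian density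
of variance `1 + P`, up to a constant factor per channel use and the normalization; this is the
corresponding inequality between the exponents. -/
lemma energy_received_le (c : Scheme K n M P) (hP : 0 < P) (h : Matrix (Fin K) (Fin K) ℂ)
    (y : Fin K → Fin n → ℂ) (w : ∀ i, Fin (M i)) (i : Fin K) :
    (1 + P)⁻¹ * energy (y i) ≤ energy ((y - c.signal h w) i) + n * gain h i := by
  have h1 := energy_add_le ((y - c.signal h w) i) (c.signal h w i) hP
  have h2 : energy (c.signal h w i) / P ≤ n * gain h i := by
    rw [div_le_iff₀ hP]; exact c.energy_signal_le h w i
  simp only [Pi.sub_apply, sub_add_cancel] at h1 ⊢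
  linarith

/-! ### The cut that separates all transmitters from all receivers -/

/-- Even a decoder that observes all the received signals is limited by the channel with `K`
transmit and `K` receive antennas. -/
theorem prod_mul_law_correct_le (hM : ∀ i, 0 < M i) (c : Scheme K n M P) (hP : 0 < P)
    (h : Matrix (Fin K) (Fin K) ℂ) :
    (∏ i, (M i : ℝ≥0∞)) * law K n M {ω | c.decoded (c.received h ω) = ω.1} ≤
      ENNReal.ofReal ((Real.exp (∑ i, gain h i) * (1 + P) ^ K) ^ n) := by
  have hM0 : (∏ i, (M i : ℝ≥0∞)) ≠ 0 :=
    Finset.prod_ne_zero_iff.2 fun i _ => by simpa using (hM i).ne'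
  have hMt : (∏ i, (M i : ℝ≥0∞)) ≠ ⊤ := ENNReal.prod_ne_top fun i _ => by simp
  have h1 := c.law_correct hM h MeasurableSet.univ
  simp only [Set.mem_univ, true_and, Measure.restrict_univ] at h1
  rw [h1, ← mul_assoc, ENNReal.mul_inv_cancel hM0 hMt, one_mul]
  calc ∫⁻ y, noiseDensity (y - c.signal h (c.decoded y))
      ≤ ∫⁻ y : Fin K → Fin n → ℂ,
          ENNReal.ofReal Real.pi⁻¹ ^ (K * n) * ENNReal.ofReal (Real.exp (n * ∑ i, gain h i)) *
          ENNReal.ofReal (Real.exp (-(1 + P)⁻¹ * ∑ j, energy (y j))) := by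
        refine lintegral_mono fun y => ?_
        rw [noiseDensity, mul_assoc]
        refine mul_le_mul_right ?_ _
        rw [← ENNReal.ofReal_mul (Real.exp_pos _).le, ← Real.exp_add]
        refine ENNReal.ofReal_le_ofReal (Real.exp_le_exp.2 ?_)
        have h2 := Finset.sum_le_sum fun i (_ : i ∈ Finset.univ) =>
          c.energy_received_le hP h y (c.decoded y) i
        rw [← Finset.mul_sum, Finset.sum_add_distrib, ← Finset.mul_sum] at h2
        linarith
    _ = _ := by
        rw [lintegral_const_mul _ (by fun_prop),
          lintegral_exp_neg_mul_sum_energy (by positivity : 0 < (1 + P)⁻¹)]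
        simp only [Fintype.card_fin]
        rw [← ENNReal.ofReal_pow (by positivity), ← ENNReal.ofReal_pow (by positivity),
          ← ENNReal.ofReal_mul (by positivity), ← ENNReal.ofReal_mul (by positivity)]
        congr 1
        rw [Real.exp_nat_mul, mul_pow, ← pow_mul, div_inv_eq_mul, mul_pow, inv_pow]
        field_simp

/-! ### The cut around one receiver and its predecessor -/

/-- The deviation of the signal at receiver `j` from its prediction out of the signal at `a'`, when
the messages of all transmitters but `a` are known. The signal at `a'` gives the codeword of `a` up
to the noise of `a'` divided by `h a' a`, so that the error of the prediction is the noise of `j`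
minus `h j a / h a' a` times the noise of `a'`. -/
noncomputable def residual (c : Scheme K n M P) (h : Matrix (Fin K) (Fin K) ℂ) (a a' : Fin K)
    (y : Fin K → Fin n → ℂ) (w : ∀ i, Fin (M i)) (j : Fin K) : Fin n → ℂ :=
  (y - c.signal h w) j - (h j a / h a' a) • (y - c.signal h w) a'

/-- The residual does not depend on the message of the transmitter `a`. -/
lemma residual_congr (c : Scheme K n M P) {h : Matrix (Fin K) (Fin K) ℂ} {a a' : Fin K}
    (ha : h a' a ≠ 0) (y : Fin K → Fin n → ℂ) {w v : ∀ i, Fin (M i)}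
    (hwv : ∀ i ≠ a, w i = v i) (j : Fin K) :
    c.residual h a a' y w j = c.residual h a a' y v j := by
  have key : ∀ i t, c.signal h w i t - c.signal h v i t =
      h i a * (c.enc a (w a) t - c.enc a (v a) t) := fun i t => by
    simp only [signal]
    rw [← Finset.sum_sub_distrib, Finset.sum_eq_single a]
    · ring
    · intro l _ hl; rw [hwv l hl]; ring
    · simp
  ext t
  have h1 := key j t
  have h2 := key a' t
  have h3 : h j a / h a' a * (h a' a * (c.enc a (w a) t - c.enc a (v a) t)) =
      h j a * (c.enc a (w a) t - c.enc a (v a) t) := by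
    field_simp
  simp only [residual, Pi.sub_apply, Pi.smul_apply, smul_eq_mul]
  linear_combination -h1 + (h j a / h a' a) * h2 + h3

lemma residual_energy_le (c : Scheme K n M P) (h : Matrix (Fin K) (Fin K) ℂ) (a a' : Fin K)
    (y : Fin K → Fin n → ℂ) (w : ∀ i, Fin (M i)) :
    residualShare h a a' * ∑ j : {j // j ≠ a'}, energy (c.residual h a a' y w j) +
        1 / 2 * energy ((y - c.signal h w) a') ≤
      ∑ j, energy ((y - c.signal h w) j) := by
  set z := y - c.signal h w
  set ρ := ∑ j, ‖h j a / h a' a‖ ^ 2 with hρ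
  have hρ0 : 0 ≤ ρ := Finset.sum_nonneg fun _ _ => by positivity
  have h1 : ∑ j : {j // j ≠ a'}, energy (c.residual h a a' y w j) ≤
      2 * ∑ j, energy (z j) + 2 * ρ * energy (z a') := by
    calc _ ≤ ∑ j : {j // j ≠ a'},
          (2 * energy (z j) + 2 * ‖h j a / h a' a‖ ^ 2 * energy (z a')) :=
        Finset.sum_le_sum fun j _ => energy_sub_smul_le _ _ _
      _ ≤ ∑ j, (2 * energy (z j) + 2 * ‖h j a / h a' a‖ ^ 2 * energy (z a')) := by
        rw [← Finset.sum_subtype (Finset.univ.filter (· ≠ a')) (by simp)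
          (fun j => 2 * energy (z j) + 2 * ‖h j a / h a' a‖ ^ 2 * energy (z a'))]
        refine Finset.sum_le_univ_sum_of_nonneg fun j => ?_
        have := energy_nonneg (z j)
        have := energy_nonneg (z a')
        positivity
      _ = _ := by
        rw [Finset.sum_add_distrib, ← Finset.mul_sum, ← Finset.sum_mul, ← Finset.mul_sum]
  have h2 : energy (z a') ≤ ∑ j, energy (z j) :=
    Finset.single_le_sum (f := fun j => energy (z j)) (fun j _ => energy_nonneg _)
      (Finset.mem_univ a')
  have h3 := energy_nonneg (z a')
  rw [residualShare, ← hρ, ← le_sub_iff_add_le, inv_mul_le_iff₀ (by positivity)]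
  nlinarith

end Scheme

/-- Fubini for a shear: the coordinates other than `a` may be translated by an amount that depends
on the coordinate `a`. -/
lemma lintegral_shear {κ X : Type*} [Fintype κ] [DecidableEq κ] [AddCommGroup X] [MeasureSpace X]
    [MeasurableAdd₂ X] [MeasurableNeg X]
    [SigmaFinite (volume : Measure X)] [(volume : Measure X).IsAddLeftInvariant] (a : κ)
    {F : X → ℝ≥0∞} {G : ({j // j ≠ a} → X) → ℝ≥0∞} {φ : X → {j // j ≠ a} → X}
    (hF : Measurable F) (hG : Measurable G) (hφ : Measurable φ) :
    ∫⁻ y : κ → X, F (y a) * G (fun j => y j - φ (y a) j) = (∫⁻ x, F x) * ∫⁻ v, G v := by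
  have e := volume_preserving_piEquivPiSubtypeProd (fun _ : κ => X) (fun i => i = a)
  let a₀ : {i // i = a} := ⟨a, rfl⟩
  have h1 : ∫⁻ y : κ → X, F (y a) * G (fun j => y j - φ (y a) j) =
      ∫⁻ p : ({i // i = a} → X) × ({j // j ≠ a} → X),
        F (p.1 a₀) * G (p.2 - φ (p.1 a₀)) := by
    convert! (e.lintegral_comp_emb (MeasurableEquiv.measurableEmbedding _)
      (fun p : ({i // i = a} → X) × ({j // j ≠ a} → X) => F (p.1 a₀) * G (p.2 - φ (p.1 a₀))))
  rw [h1, Measure.volume_eq_prod, lintegral_prod _ (by fun_prop)]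
  have h2 : ∀ u : {i // i = a} → X, ∫⁻ v : {j // j ≠ a} → X, F (u a₀) * G (v - φ (u a₀)) =
      F (u a₀) * ∫⁻ v, G v := fun u => by
    rw [lintegral_const_mul _ (by fun_prop), lintegral_sub_right_eq_self]
  rw [lintegral_congr h2, lintegral_mul_const _ (by fun_prop)]
  congr 1
  exact (volume_preserving_funUnique {i // i = a} X).lintegral_comp_emb
    (MeasurableEquiv.measurableEmbedding _) F

/-- The factor, per channel use and relative to `1 + P`, in the bound for the pair `a`, `a'`. -/
noncomputable def pairConst {K : ℕ} (h : Matrix (Fin K) (Fin K) ℂ) (a a' : Fin K) : ℝ :=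
  2 * Real.exp (gain h a') * (residualShare h a a')⁻¹ ^ (K - 1)

lemma pairConst_pos {K : ℕ} (h : Matrix (Fin K) (Fin K) ℂ) (a a' : Fin K) :
    0 < pairConst h a a' := by
  have := residualShare_pos h a a'
  unfold pairConst; positivity

namespace Scheme

variable {K n : ℕ} {M : Fin K → ℕ} {P : ℝ}

/-- The messages `w`, with the message of user `i` replaced by what receiver `i` decides when it
observes `u` on the channel and receives `s` from the other receivers. -/
def decideAt (c : Scheme K n M P) (i : Fin K) (w : ∀ i, Fin (M i))
    (s : ∀ l : {l : Fin K // l ≠ i}, Fin n → Fin (c.b l i)) (u : Fin n → ℂ) : ∀ i, Fin (M i) :=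
  Function.update w i (c.dec i (u, s))

lemma measurable_decideAt (c : Scheme K n M P) (i : Fin K) (w : ∀ i, Fin (M i))
    (s : ∀ l : {l : Fin K // l ≠ i}, Fin n → Fin (c.b l i)) : Measurable (c.decideAt i w s) := by
  have h1 : Measurable fun u : Fin n → ℂ => c.dec i (u, s) :=
    (c.measurable_dec i).comp (measurable_id.prodMk measurable_const)
  exact (measurable_of_finite (Function.update w i)).comp h1

/-- The function that dominates the density of the received signals: a centred Gaussian at receiver
`a'`, times Gaussians around the other signals predicted from the one at `a'` and the
messages `c.decideAt a' w s (y a')`. -/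
noncomputable def pairDensity (c : Scheme K n M P) (h : Matrix (Fin K) (Fin K) ℂ) (a a' : Fin K)
    (w : ∀ i, Fin (M i)) (s : ∀ l : {l : Fin K // l ≠ a'}, Fin n → Fin (c.b l a'))
    (y : Fin K → Fin n → ℂ) : ℝ≥0∞ :=
  ENNReal.ofReal (Real.pi⁻¹ ^ (K * n) * Real.exp (n * gain h a')) *
    (ENNReal.ofReal (Real.exp (-(2 * (1 + P))⁻¹ * energy (y a'))) *
      ENNReal.ofReal (Real.exp (-residualShare h a a' * ∑ j : {j // j ≠ a'},
        energy (c.residual h a a' y (c.decideAt a' w s (y a')) j))))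

lemma measurable_pairDensity (c : Scheme K n M P) (h : Matrix (Fin K) (Fin K) ℂ) (a a' : Fin K)
    (w : ∀ i, Fin (M i)) (s : ∀ l : {l : Fin K // l ≠ a'}, Fin n → Fin (c.b l a')) :
    Measurable (c.pairDensity h a a' w s) := by
  have hsig : Measurable fun y : Fin K → Fin n → ℂ => c.signal h (c.decideAt a' w s (y a')) :=
    (measurable_of_finite (c.signal h)).comp
      ((c.measurable_decideAt a' w s).comp (measurable_pi_apply a'))
  have hz : ∀ j, Measurable fun y : Fin K → Fin n → ℂ =>
      (y - c.signal h (c.decideAt a' w s (y a'))) j := fun j =>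
    (measurable_pi_apply j).comp (measurable_id.sub hsig)
  have hres : ∀ j, Measurable fun y : Fin K → Fin n → ℂ =>
      c.residual h a a' y (c.decideAt a' w s (y a')) j := fun j =>
    (hz j).sub (Measurable.const_smul (hz a') (h j a / h a' a))
  unfold pairDensity
  fun_prop

lemma lintegral_pairDensity (c : Scheme K n M P) (hP : 0 < P) (h : Matrix (Fin K) (Fin K) ℂ)
    {a a' : Fin K} (w : ∀ i, Fin (M i))
    (s : ∀ l : {l : Fin K // l ≠ a'}, Fin n → Fin (c.b l a')) :
    ∫⁻ y, c.pairDensity h a a' w s y = ENNReal.ofReal ((pairConst h a a' * (1 + P)) ^ n) := by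
  have hs := residualShare_pos h a a'
  let f : (Fin n → ℂ) → ∀ i, Fin (M i) := c.decideAt a' w s
  have hf : Measurable f := c.measurable_decideAt a' w s
  let φ : (Fin n → ℂ) → {j // j ≠ a'} → Fin n → ℂ := fun u j =>
    c.signal h (f u) j + (h j a / h a' a) • (u - c.signal h (f u) a')
  have hsig : Measurable fun u => c.signal h (f u) := (measurable_of_finite (c.signal h)).comp hf
  have hφ : Measurable φ := by
    refine measurable_pi_lambda _ fun j => ?_
    have h1 : Measurable fun u => c.signal h (f u) j := (measurable_pi_apply _).comp hsig
    have h2 : Measurable fun u => c.signal h (f u) a' := (measurable_pi_apply _).comp hsig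
    exact h1.add (Measurable.const_smul (measurable_id.sub h2) (h j a / h a' a))
  have hφ' : ∀ y : Fin K → Fin n → ℂ, ∀ j : {j // j ≠ a'},
      c.residual h a a' y (c.decideAt a' w s (y a')) j = y j - φ (y a') j := fun y j => by
    simp only [residual, φ, f, Pi.sub_apply]
    abel
  have hG : Measurable fun v : {j // j ≠ a'} → Fin n → ℂ =>
      ENNReal.ofReal (Real.exp (-residualShare h a a' * ∑ j, energy (v j))) := by fun_prop
  have hF : Measurable fun u : Fin n → ℂ =>
      ENNReal.ofReal (Real.exp (-(2 * (1 + P))⁻¹ * energy u)) := by fun_prop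
  have hshift : Measurable fun y : Fin K → Fin n → ℂ => fun j : {j // j ≠ a'} =>
      y j - φ (y a') j := by
    refine measurable_pi_lambda _ fun j => (measurable_pi_apply _).sub ?_
    exact (measurable_pi_apply j).comp (hφ.comp (measurable_pi_apply a'))
  simp only [pairDensity, hφ']
  rw [lintegral_const_mul]
  swap
  · exact (hF.comp (measurable_pi_apply a')).mul (hG.comp hshift)
  rw [lintegral_shear a' hF hG hφ, lintegral_exp_neg_mul_energy (by positivity),
    lintegral_exp_neg_mul_sum_energy hs]
  have hcard : Fintype.card {j : Fin K // j ≠ a'} = K - 1 := by simp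
  have hK : K = K - 1 + 1 := by have := a'.pos; omega
  simp only [hcard, Fintype.card_fin]
  rw [← ENNReal.ofReal_pow (by positivity), ← ENNReal.ofReal_pow (by positivity),
    ← ENNReal.ofReal_mul (by positivity), ← ENNReal.ofReal_mul (by positivity)]
  congr 1
  have hpi : Real.pi⁻¹ ^ (K * n) = (Real.pi⁻¹ ^ (K - 1) * Real.pi⁻¹) ^ n := by
    rw [pow_mul, ← pow_succ, ← hK]
  rw [hpi, Real.exp_nat_mul, pow_mul, ← mul_pow, ← mul_pow, ← mul_pow, pairConst]
  congr 1
  rw [div_inv_eq_mul, div_pow, inv_pow, inv_pow]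
  field_simp

/-- Where receiver `a'` obtains the symbols `s`, the density of the received signals for the decoded
messages is dominated by `pairDensity` for any messages `w` that differ from the decoded ones
only for the users `a` and `a'`: the message of `a'` is decided from `y a'` and `s`, and the
residuals do not depend on the message of `a`. -/
lemma noiseDensity_le_pairDensity (c : Scheme K n M P) (hP : 0 < P)
    (h : Matrix (Fin K) (Fin K) ℂ) {a a' : Fin K} (ha : h a' a ≠ 0) (y : Fin K → Fin n → ℂ)
    {w : ∀ i, Fin (M i)} (hw : ∀ i, i ≠ a → i ≠ a' → w i = c.decoded y i) :
    noiseDensity (y - c.signal h (c.decoded y)) ≤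
      c.pairDensity h a a' w (c.incoming y a') y := by
  have hres : ∀ j, c.residual h a a' y (c.decideAt a' w (c.incoming y a') (y a')) j =
      c.residual h a a' y (c.decoded y) j := by
    refine c.residual_congr ha y fun i hi => ?_
    by_cases hi' : i = a'
    · subst hi'
      rw [decideAt, Function.update_self]
      rfl
    · simp [decideAt, hi', hw i hi hi']
  rw [noiseDensity, pairDensity]
  simp only [hres]
  rw [← ENNReal.ofReal_pow (by positivity), ← ENNReal.ofReal_mul (by positivity),
    ← ENNReal.ofReal_mul (by positivity), ← ENNReal.ofReal_mul (by positivity), mul_assoc,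
    ← Real.exp_add, ← Real.exp_add]
  refine ENNReal.ofReal_le_ofReal (mul_le_mul_of_nonneg_left (Real.exp_le_exp.2 ?_)
    (by positivity))
  have h1 := c.residual_energy_le h a a' y (c.decoded y)
  have h2 := c.energy_received_le hP h y (c.decoded y) a'
  have h3 : 0 ≤ n * gain h a' := by unfold gain; positivity
  have h4 : (2 * (1 + P))⁻¹ * energy (y a') = 1 / 2 * ((1 + P)⁻¹ * energy (y a')) := by
    rw [mul_inv]; ring
  linarith

/-- If receiver `a'` hears transmitter `a`, then its own signal and the symbols that it obtains
from the other receivers, of which there are at most `S.card`, limit the number of messages of `a`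
and `a'` jointly. -/
theorem mul_law_correct_le (hM : ∀ i, 0 < M i) (c : Scheme K n M P) (hP : 0 < P)
    (h : Matrix (Fin K) (Fin K) ℂ) {a a' : Fin K} (haa : a ≠ a') (ha : h a' a ≠ 0)
    (S : Finset (∀ l : {l : Fin K // l ≠ a'}, Fin n → Fin (c.b l a'))) :
    (M a * M a' : ℝ≥0∞) * law K n M {ω | c.incoming (c.received h ω) a' ∈ S ∧
        c.decoded (c.received h ω) = ω.1} ≤
      S.card * ENNReal.ofReal ((pairConst h a a' * (1 + P)) ^ n) := by
  classical
  set D := ENNReal.ofReal ((pairConst h a a' * (1 + P)) ^ n)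
  have hM0 : (∏ i, (M i : ℝ≥0∞)) ≠ 0 :=
    Finset.prod_ne_zero_iff.2 fun i _ => by simpa using (hM i).ne'
  have hMt : (∏ i, (M i : ℝ≥0∞)) ≠ ⊤ := ENNReal.prod_ne_top fun i _ => by simp
  have hA : MeasurableSet {y | c.incoming y a' ∈ S} :=
    c.measurable_incoming a' S.measurableSet
  have h1 := c.law_correct hM h hA
  rw [show {ω : Outcome K n M | c.incoming (c.received h ω) a' ∈ S ∧
    c.decoded (c.received h ω) = ω.1} = {ω | c.received h ω ∈ {y | c.incoming y a' ∈ S} ∧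
    c.decoded (c.received h ω) = ω.1} from rfl, h1]
  -- Replacing the messages of `a` and `a'` by arbitrary ones gives `M a * M a'` terms.
  have hpt : ∀ y ∈ {y | c.incoming y a' ∈ S},
      (M a * M a' : ℝ≥0∞) * noiseDensity (y - c.signal h (c.decoded y)) ≤
        ∑ w, ∑ s ∈ S, c.pairDensity h a a' w s y := by
    intro y hy
    let φ : Fin (M a) × Fin (M a') → ∀ i, Fin (M i) := fun p =>
      Function.update (Function.update (c.decoded y) a p.1) a' p.2
    have hφ : Function.Injective φ := fun p q hpq => by
      have e1 := congrFun hpq a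
      have e2 := congrFun hpq a'
      simp only [φ, Function.update_self, Function.update_of_ne haa] at e1 e2
      exact Prod.ext e1 e2
    calc (M a * M a' : ℝ≥0∞) * noiseDensity (y - c.signal h (c.decoded y))
        = ∑ p : Fin (M a) × Fin (M a'), noiseDensity (y - c.signal h (c.decoded y)) := by simp
      _ ≤ ∑ p, ∑ s ∈ S, c.pairDensity h a a' (φ p) s y := by
          refine Finset.sum_le_sum fun p _ => ?_
          refine (c.noiseDensity_le_pairDensity hP h ha y (w := φ p) fun i hi hi' => ?_).trans
            (Finset.single_le_sum (f := fun s => c.pairDensity h a a' (φ p) s y)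
              (fun _ _ => zero_le) hy)
          simp [φ, hi, hi']
      _ = ∑ w ∈ Finset.univ.image φ, ∑ s ∈ S, c.pairDensity h a a' w s y := by
          rw [Finset.sum_image hφ.injOn]
      _ ≤ _ := Finset.sum_le_univ_sum_of_nonneg fun _ => zero_le
  have hint : (M a * M a' : ℝ≥0∞) * ∫⁻ y in {y | c.incoming y a' ∈ S},
      noiseDensity (y - c.signal h (c.decoded y)) ≤ (∏ i, (M i : ℝ≥0∞)) * (S.card * D) := by
    have hm : Measurable fun y => noiseDensity (y - c.signal h (c.decoded y)) :=
      measurable_noiseDensity.comp (measurable_id.sub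
        ((measurable_of_finite (c.signal h)).comp c.measurable_decoded))
    rw [← lintegral_const_mul _ hm]
    calc _ ≤ ∫⁻ y in {y | c.incoming y a' ∈ S}, ∑ w, ∑ s ∈ S, c.pairDensity h a a' w s y :=
          setLIntegral_mono' hA hpt
      _ ≤ ∫⁻ y, ∑ w, ∑ s ∈ S, c.pairDensity h a a' w s y := setLIntegral_le_lintegral _ _
      _ = ∑ w : ∀ i, Fin (M i), ∑ s ∈ S, D := by
          rw [lintegral_finsetSum _ fun w _ => Finset.measurable_sum _ fun s _ =>
            c.measurable_pairDensity h a a' w s]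
          refine Finset.sum_congr rfl fun w _ => ?_
          rw [lintegral_finsetSum _ fun s _ => c.measurable_pairDensity h a a' w s]
          exact Finset.sum_congr rfl fun s _ => c.lintegral_pairDensity hP h w s
      _ = _ := by simp
  calc _ = (∏ i, (M i : ℝ≥0∞))⁻¹ * ((M a * M a' : ℝ≥0∞) *
        ∫⁻ y in {y | c.incoming y a' ∈ S}, noiseDensity (y - c.signal h (c.decoded y))) := by
        rw [← mul_assoc, mul_comm (M a * M a' : ℝ≥0∞), mul_assoc]
    _ ≤ (∏ i, (M i : ℝ≥0∞))⁻¹ * ((∏ i, (M i : ℝ≥0∞)) * (S.card * D)) :=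
        mul_le_mul_right hint _
    _ = S.card * D := by rw [← mul_assoc, ENNReal.inv_mul_cancel hM0 hMt, one_mul]

end Scheme

/-! ### Bounds for achievable rates -/

namespace Scheme

variable {K n : ℕ} {M : Fin K → ℕ} {P : ℝ}

lemma setOf_error_compl (c : Scheme K n M P) (h : Matrix (Fin K) (Fin K) ℂ) :
    {ω : Outcome K n M | ∃ i, c.decoded (c.received h ω) i ≠ ω.1 i} =
      {ω | c.decoded (c.received h ω) = ω.1}ᶜ := by
  ext ω
  simp [funext_iff]

/-- The logarithm of the bound for the cut that separates all transmitters from all receivers, for a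
scheme that succeeds with probability at least `1 / 2`. -/
lemma log_prod_le (hM : ∀ i, 0 < M i) (c : Scheme K n M P) (hP : 0 < P)
    (h : Matrix (Fin K) (Fin K) ℂ) (herr : c.errorProb h < 1 / 2) :
    ∑ i, Real.log (M i) ≤
      Real.log 2 + n * (∑ i, gain h i + K * Real.log (1 + P)) := by
  have := isProbabilityMeasure_law (n := n) hM
  set E := {ω : Outcome K n M | c.decoded (c.received h ω) = ω.1}
  have h1 : 1 / 2 ≤ (law K n M).real E := by
    have h2 : (law K n M).real Set.univ ≤ (law K n M).real E + (law K n M).real Eᶜ := by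
      rw [← Set.union_compl_self E]
      exact measureReal_union_le _ _
    rw [errorProb, setOf_error_compl] at herr
    simp only [probReal_univ] at h2
    linarith
  have h3 : (∏ i, (M i : ℝ)) * (law K n M).real E ≤
      (Real.exp (∑ i, gain h i) * (1 + P) ^ K) ^ n := by
    have h4 := ENNReal.toReal_mono ENNReal.ofReal_ne_top (c.prod_mul_law_correct_le hM hP h)
    rw [ENNReal.toReal_ofReal (by positivity), ENNReal.toReal_mul, ENNReal.toReal_prod] at h4
    simp only [ENNReal.toReal_natCast] at h4
    exact h4
  have hprod : 0 < ∏ i, (M i : ℝ) := Finset.prod_pos fun i _ => by exact_mod_cast hM i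
  have h5 : (∏ i, (M i : ℝ)) ≤ 2 * (Real.exp (∑ i, gain h i) * (1 + P) ^ K) ^ n := by
    nlinarith
  have h6 := Real.log_le_log hprod h5
  rw [Real.log_prod fun i _ => by exact_mod_cast (hM i).ne',
    Real.log_mul (by norm_num) (by positivity), Real.log_pow,
    Real.log_mul (by positivity) (by positivity), Real.log_exp, Real.log_pow] at h6
  exact h6

/-- The logarithm of the bound for the pair `a`, `a'`. The symbols sent to `a'` are restricted to a
typical set, whose complement has probability at most `1 / r`, so that their number is bounded in
terms of the entropies of the links; the error probability is small enough for the remaining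
correct outcomes to have probability at least `(1 - 1 / r) / 2`. -/
lemma log_add_log_le (hM : ∀ i, 0 < M i) (c : Scheme K n M P) (hP : 0 < P) (hn : 0 < n)
    (h : Matrix (Fin K) (Fin K) ℂ) {a a' : Fin K} (haa : a ≠ a') (ha : h a' a ≠ 0)
    {r : ℝ} (hr : 1 < r) (herr : c.errorProb h < (1 - 1 / r) / 2) :
    Real.log (M a) + Real.log (M a') ≤
      r * (n * (∑ l : {l // l ≠ a'}, c.linkRate h l a') * Real.log 2 + 1) -
        Real.log ((1 - 1 / r) / 2) +
        n * (Real.log (pairConst h a a') + Real.log (1 + P)) := by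
  have := isProbabilityMeasure_law (n := n) hM
  have hδ : 0 < (1 - 1 / r) / 2 := by
    have : 1 / r < 1 := by rw [div_lt_one (by linarith)]; exact hr
    linarith
  obtain ⟨S, hS, hS'⟩ := exists_typical_set (μ := law K n M)
    (X := fun (l : {l // l ≠ a'}) ω => c.incoming (c.received h ω) a' l)
    (fun l => (measurable_pi_apply l).comp
      ((c.measurable_incoming a').comp (c.measurable_received h))) (by linarith : 0 < r)
  have hent : ∑ l : {l // l ≠ a'}, entropy (law K n M)
      (fun ω => c.incoming (c.received h ω) a' l) =
        n * ∑ l : {l // l ≠ a'}, c.linkRate h l a' := by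
    have hn' : (n : ℝ) ≠ 0 := by exact_mod_cast hn.ne'
    rw [Finset.mul_sum]
    refine Finset.sum_congr rfl fun l _ => ?_
    rw [linkRate, ← mul_assoc, mul_one_div_cancel hn', one_mul]
    rfl
  rw [hent] at hS
  set E := {ω : Outcome K n M | c.decoded (c.received h ω) = ω.1}
  set T := {ω : Outcome K n M | c.incoming (c.received h ω) a' ∉ S}
  set G := {ω : Outcome K n M | c.incoming (c.received h ω) a' ∈ S ∧
    c.decoded (c.received h ω) = ω.1}
  have hT : (law K n M).real T ≤ 1 / r := by
    refine ENNReal.toReal_le_of_le_ofReal (by positivity) hS'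
  have h1 : (1 - 1 / r) / 2 ≤ (law K n M).real G := by
    have hcover : Set.univ ⊆ G ∪ (Eᶜ ∪ T) := by
      intro ω _
      simp only [G, E, T, Set.mem_union, Set.mem_ofPred_eq, Set.mem_compl_iff]
      tauto
    have h2 : (law K n M).real Set.univ ≤
        (law K n M).real G + ((law K n M).real Eᶜ + (law K n M).real T) :=
      (measureReal_mono hcover).trans ((measureReal_union_le _ _).trans
        (add_le_add le_rfl (measureReal_union_le _ _)))
    rw [errorProb, setOf_error_compl] at herr
    simp only [probReal_univ] at h2
    linarith
  have hD := pairConst_pos h a a'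
  have h3 : (M a * M a' : ℝ) * (law K n M).real G ≤
      S.card * (pairConst h a a' * (1 + P)) ^ n := by
    have h4 := ENNReal.toReal_mono (by finiteness) (c.mul_law_correct_le hM hP h haa ha S)
    simp only [ENNReal.toReal_mul, ENNReal.toReal_natCast] at h4
    rwa [ENNReal.toReal_ofReal (by positivity)] at h4
  have ha0 : (0 : ℝ) < M a := by exact_mod_cast hM a
  have ha0' : (0 : ℝ) < M a' := by exact_mod_cast hM a'
  have h5 : (M a * M a' : ℝ) * ((1 - 1 / r) / 2) ≤
      Real.exp (r * (n * (∑ l : {l // l ≠ a'}, c.linkRate h l a') * Real.log 2 + 1)) *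
        (pairConst h a a' * (1 + P)) ^ n :=
    (mul_le_mul_of_nonneg_left h1 (by positivity)).trans
      (h3.trans (mul_le_mul_of_nonneg_right hS (by positivity)))
  have h6 := Real.log_le_log (by positivity) h5
  rw [Real.log_mul (by positivity) hδ.ne', Real.log_mul ha0.ne' ha0'.ne',
    Real.log_mul (Real.exp_pos _).ne' (by positivity), Real.log_exp, Real.log_pow,
    Real.log_mul (by positivity) (by positivity)] at h6
  linarith

/-- Grouping the links by their receiving end gives the total backhaul rate. -/
lemma sum_linkRate (c : Scheme K n M P) (hK : 0 < K) (h : Matrix (Fin K) (Fin K) ℂ) :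
    ∑ i, ∑ l : {l // l ≠ i}, c.linkRate h l i = K * c.backhaulRate h := by
  have hK' : (K : ℝ) ≠ 0 := by exact_mod_cast hK.ne'
  rw [backhaulRate, ← mul_assoc, mul_one_div_cancel hK', one_mul]
  simp_rw [Finset.sum_filter]
  rw [Finset.sum_comm]
  refine Finset.sum_congr rfl fun i _ => ?_
  rw [← Finset.sum_subtype (Finset.univ.filter (· ≠ i)) (by simp) (fun l => c.linkRate h l i),
    Finset.sum_filter]
  exact Finset.sum_congr rfl fun l _ => by simp [eq_comm]

end Scheme

lemma floor_two_rpow_pos {x : ℝ} (hx : 0 ≤ x) : 0 < ⌊(2 : ℝ) ^ x⌋₊ :=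
  Nat.floor_pos.2 (Real.one_le_rpow (by norm_num) hx)

lemma mul_log_two_le_log_floor {x : ℝ} (hx : 0 ≤ x) :
    x * Real.log 2 - Real.log 2 ≤ Real.log ⌊(2 : ℝ) ^ x⌋₊ := by
  have h1 : (1 : ℝ) ≤ ⌊(2 : ℝ) ^ x⌋₊ := by exact_mod_cast floor_two_rpow_pos hx
  have h2 := Nat.lt_floor_add_one ((2 : ℝ) ^ x)
  have h3 : (2 : ℝ) ^ x / 2 ≤ ⌊(2 : ℝ) ^ x⌋₊ := by linarith
  have h4 := Real.log_le_log (by positivity) h3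
  rwa [Real.log_div (by positivity) (by norm_num), Real.log_rpow (by norm_num)] at h4

lemma le_of_forall_nat_mul_le {x y z : ℝ} {N : ℕ} (h : ∀ n : ℕ, N ≤ n → n * x ≤ y + n * z) :
    x ≤ z := by
  by_contra! hlt
  obtain ⟨m, hm⟩ := exists_nat_gt (y / (x - z))
  have h1 := h (max m N) (le_max_right _ _)
  have h2 : (m : ℝ) ≤ (max m N : ℕ) := by exact_mod_cast le_max_left _ _
  have h3 : y < (max m N : ℕ) * (x - z) := by
    rw [← div_lt_iff₀ (by linarith)]; linarith
  linarith

variable {K : ℕ} {h : Matrix (Fin K) (Fin K) ℂ} {P : ℝ} {L : ℝ≥0∞} {R : Fin K → ℝ}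

/-- The bound of the channel with full receiver cooperation; it holds for every `L`. -/
theorem Achievable.sum_le (hR : Achievable h P L R) (hP : 0 < P) :
    (∑ i, R i) * Real.log 2 ≤ ∑ i, gain h i + K * Real.log (1 + P) := by
  obtain ⟨hR0, hR⟩ := hR
  obtain ⟨N, hN⟩ := hR (1 / 2) (by norm_num)
  refine le_of_forall_nat_mul_le (N := N) (y := K * Real.log 2 + Real.log 2) fun n hn => ?_
  obtain ⟨c, hc, -⟩ := hN n hn
  have hx : ∀ i, 0 ≤ (n : ℝ) * R i := fun i => mul_nonneg n.cast_nonneg (hR0 i)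
  have h1 := c.log_prod_le (fun i => floor_two_rpow_pos (hx i)) hP h hc
  have h2 := Finset.sum_le_sum fun i (_ : i ∈ Finset.univ) => mul_log_two_le_log_floor (hx i)
  rw [Finset.sum_sub_distrib, ← Finset.sum_mul, ← Finset.mul_sum] at h2
  simp only [Finset.sum_const, Finset.card_univ, Fintype.card_fin, nsmul_eq_mul] at h2
  linarith

/-- The sum over all receivers of the bounds for the pairs of cyclically neighbouring users. Every
rate occurs in two pairs, every link in one. -/
theorem Achievable.two_mul_sum_le (hK : 2 ≤ K) (hcross : ∀ i : Fin K, h (finRotate K i) i ≠ 0)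
    (hR : Achievable h P L R) (hP : 0 < P) (hL : L ≠ ⊤) :
    2 * (∑ i, R i) * Real.log 2 ≤ K * L.toReal * Real.log 2 +
      (∑ i, Real.log (pairConst h i (finRotate K i)) + K * Real.log (1 + P)) := by
  obtain ⟨hR0, hR⟩ := hR
  have hne : ∀ i : Fin K, i ≠ finRotate K i := fun i hi => by
    obtain ⟨k, rfl⟩ : ∃ k, K = k + 2 := ⟨K - 2, by omega⟩
    rw [finRotate_apply] at hi
    simp at hi
  set B := ∑ i, Real.log (pairConst h i (finRotate K i)) + K * Real.log (1 + P) with hB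
  -- The slack factor `r > 1` of the typical set is removed at the very end.
  have key : ∀ r : ℝ, 1 < r →
      2 * (∑ i, R i) * Real.log 2 ≤ r * (K * L.toReal * Real.log 2) + B := by
    intro r hr
    have hδ : 0 < (1 - 1 / r) / 2 := by
      have : 1 / r < 1 := by rw [div_lt_one (by linarith)]; exact hr
      linarith
    obtain ⟨N, hN⟩ := hR _ hδ
    refine le_of_forall_nat_mul_le (N := max N 1)
      (y := 2 * K * Real.log 2 + K * r - K * Real.log ((1 - 1 / r) / 2)) fun n hn => ?_
    obtain ⟨c, hc, hcL⟩ := hN n (le_of_max_le_left hn)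
    have hn0 : 0 < n := le_of_max_le_right hn
    have hx : ∀ i, 0 ≤ (n : ℝ) * R i := fun i => mul_nonneg n.cast_nonneg (hR0 i)
    have hback : c.backhaulRate h ≤ L.toReal := (ENNReal.ofReal_le_iff_le_toReal hL).1 hcL
    have h1 := Finset.sum_le_sum fun i (_ : i ∈ Finset.univ) =>
      c.log_add_log_le (fun i => floor_two_rpow_pos (hx i)) hP hn0 h (hne i) (hcross i) hr hc
    have h2 := Finset.sum_le_sum fun i (_ : i ∈ Finset.univ) => mul_log_two_le_log_floor (hx i)
    rw [Finset.sum_sub_distrib, ← Finset.sum_mul, ← Finset.mul_sum] at h2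
    have h3 := Equiv.sum_comp (finRotate K) fun i =>
      Real.log (⌊(2 : ℝ) ^ ((n : ℝ) * R i)⌋₊ : ℝ)
    have h4 := Equiv.sum_comp (finRotate K) fun i => ∑ l : {l // l ≠ i}, c.linkRate h l i
    rw [c.sum_linkRate (by omega)] at h4
    simp only [Finset.sum_add_distrib, Finset.sum_sub_distrib, ← Finset.mul_sum, ← Finset.sum_mul,
      Finset.sum_const, Finset.card_univ, Fintype.card_fin, nsmul_eq_mul] at h1 h2
    rw [h3, h4] at h1
    have h5 : r * (n * (K * c.backhaulRate h) * Real.log 2) ≤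
        r * (n * (K * L.toReal) * Real.log 2) := by
      have := Real.log_pos one_lt_two
      gcongr
    rw [hB]
    linarith
  refine le_of_tendsto_of_tendsto tendsto_const_nhds (b := 𝓝[>] (1 : ℝ))
    (f := fun _ => 2 * (∑ i, R i) * Real.log 2)
    (g := fun r => r * (K * L.toReal * Real.log 2) + B) ?_ ?_
  · have : Tendsto (fun r : ℝ => r * (K * L.toReal * Real.log 2) + B) (𝓝 1)
        (𝓝 (1 * (K * L.toReal * Real.log 2) + B)) :=
      Continuous.tendsto (by fun_prop) 1
    rw [one_mul] at this
    exact this.mono_left nhdsWithin_le_nhds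
  · filter_upwards [self_mem_nhdsWithin] with r hr using key r hr

/-! ### Degrees of freedom -/

lemma log_one_add_le {P : ℝ} (hP : 1 < P) :
    Real.log (1 + P) ≤ (1 + Real.logb 2 P) * Real.log 2 := by
  have h2 := Real.log_pos one_lt_two
  have h1 : Real.log (1 + P) ≤ Real.log (2 * P) := Real.log_le_log (by linarith) (by linarith)
  rw [Real.log_mul (by norm_num) (by linarith)] at h1
  rw [Real.logb, add_mul, div_mul_cancel₀ _ h2.ne', one_mul]
  exact h1

lemma tendsto_ofReal_one_add_div_logb (C : ℝ) :
    Tendsto (fun P : ℝ => ENNReal.ofReal (1 + C / Real.logb 2 P)) atTop (𝓝 1) := by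
  have h1 : Tendsto (fun P : ℝ => 1 + C / Real.logb 2 P) atTop (𝓝 (1 + 0)) :=
    tendsto_const_nhds.add (tendsto_const_nhds.div_atTop (Real.tendsto_logb_atTop one_lt_two))
  simpa using ENNReal.tendsto_ofReal h1

lemma dof_le_of_tendsto {R : ℝ → Fin K → ℝ} {u : ℝ → ℝ≥0∞} {d : ℝ≥0∞} (hu : Tendsto u atTop (𝓝 d))
    (hle : ∀ᶠ P in atTop, ENNReal.ofReal ((∑ k, R P k) / (K * Real.logb 2 P)) ≤ u P) :
    dof R ≤ d :=
  (liminf_le_liminf hle).trans_eq hu.liminf_eq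

lemma dof_le_one (hK : 0 < K) {L : ℝ → ℝ≥0∞} {R : ℝ → Fin K → ℝ}
    (hR : ∀ P > 0, Achievable h P (L P) (R P)) : dof R ≤ 1 := by
  have hlog2 := Real.log_pos one_lt_two
  have hK' : (0 : ℝ) < K := by exact_mod_cast hK
  set C := 1 + (∑ i, gain h i) / (K * Real.log 2) with hC
  refine dof_le_of_tendsto (tendsto_ofReal_one_add_div_logb C) ?_
  filter_upwards [eventually_gt_atTop 1] with P hP
  refine ENNReal.ofReal_le_ofReal ?_
  have hl : 0 < Real.logb 2 P := Real.logb_pos one_lt_two hP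
  have h1 := (hR P (by linarith)).sum_le (by linarith)
  have h2 := mul_le_mul_of_nonneg_left (log_one_add_le hP) hK'.le
  have h3 : (1 + C / Real.logb 2 P) * (K * Real.logb 2 P) * Real.log 2 =
      ∑ i, gain h i + K * ((1 + Real.logb 2 P) * Real.log 2) := by
    rw [hC]; field_simp; ring
  rw [div_le_iff₀ (by positivity)]
  refine le_of_mul_le_mul_right ?_ hlog2
  linarith

/-- Only a finite `α` makes `L P` eventually finite, as the bound for the pairs requires. -/
lemma dof_le_half (hK : 2 ≤ K) (hcross : ∀ i : Fin K, h (finRotate K i) i ≠ 0) {α : ℝ≥0∞}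
    (hα : α ≠ ⊤) {L : ℝ → ℝ≥0∞} {R : ℝ → Fin K → ℝ}
    (hL : Tendsto (fun P : ℝ => L P / ENNReal.ofReal (Real.logb 2 P)) atTop (𝓝 α))
    (hR : ∀ P > 0, Achievable h P (L P) (R P)) : dof R ≤ (1 + α) / 2 := by
  have hlog2 := Real.log_pos one_lt_two
  have hK' : (0 : ℝ) < K := by exact_mod_cast (by omega : 0 < K)
  set C := 1 + (∑ i, Real.log (pairConst h i (finRotate K i))) / (K * Real.log 2) with hC
  have hfin : ∀ᶠ P in atTop, L P / ENNReal.ofReal (Real.logb 2 P) < ⊤ :=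
    hL.eventually_lt_const hα.lt_top
  have hu := ENNReal.Tendsto.div_const ((tendsto_ofReal_one_add_div_logb C).add hL)
    (Or.inr two_ne_zero)
  refine dof_le_of_tendsto hu ?_
  have hbig := (tendsto_const_nhds (x := (1 : ℝ))).add
    ((tendsto_const_nhds (x := C)).div_atTop (Real.tendsto_logb_atTop one_lt_two))
  have hpos : ∀ᶠ P : ℝ in atTop, 0 < 1 + C / Real.logb 2 P :=
    hbig.eventually_const_lt (by norm_num)
  filter_upwards [eventually_gt_atTop 1, hfin, hpos] with P hP hfinP hposP
  have hl : 0 < Real.logb 2 P := Real.logb_pos one_lt_two hP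
  have hLP : L P ≠ ⊤ := by
    intro htop
    rw [htop, ENNReal.top_div_of_ne_top ENNReal.ofReal_ne_top] at hfinP
    exact lt_irrefl _ hfinP
  have h1 := (hR P (by linarith)).two_mul_sum_le hK hcross (by linarith) hLP
  have h2 := mul_le_mul_of_nonneg_left (log_one_add_le hP) hK'.le
  have h3 : ((1 + C / Real.logb 2 P + (L P).toReal / Real.logb 2 P) / 2) *
      (K * Real.logb 2 P) * (2 * Real.log 2) = K * (L P).toReal * Real.log 2 +
      (∑ i, Real.log (pairConst h i (finRotate K i)) +
        K * ((1 + Real.logb 2 P) * Real.log 2)) := by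
    rw [hC]; field_simp; ring
  have h4 : (∑ k, R P k) / (K * Real.logb 2 P) ≤
      (1 + C / Real.logb 2 P + (L P).toReal / Real.logb 2 P) / 2 := by
    rw [div_le_iff₀ (by positivity)]
    refine le_of_mul_le_mul_right ?_ (by positivity : 0 < 2 * Real.log 2)
    linarith
  refine (ENNReal.ofReal_le_ofReal h4).trans_eq ?_
  rw [ENNReal.ofReal_div_of_pos two_pos, ENNReal.ofReal_add hposP.le (by positivity),
    ENNReal.ofReal_div_of_pos hl, ENNReal.ofReal_toReal hLP, ENNReal.ofReal_ofNat]

end InterferenceChannel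

theorem theorem1 {K : ℕ} (hK : 2 ≤ K) (h : Matrix (Fin K) (Fin K) ℂ)
    (hcross : ∀ i : Fin K, h (finRotate K i) i ≠ 0) (α : ℝ≥0∞) :
    InterferenceChannel.dofStar h α ≤ min 1 ((1 + α) / 2) := by
  refine sSup_le ?_
  rintro d ⟨L, R, hL, hR, rfl⟩
  refine le_min (InterferenceChannel.dof_le_one (by omega) hR) ?_
  rcases eq_or_ne α ⊤ with rfl | hα
  · simp [ENNReal.top_div_of_ne_top]
  · exact InterferenceChannel.dof_le_half hK hcross hα hL hR
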